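/- Conventions. For a real Banach space $E$, $\mathbf O(E)$ is the group of surjective linear isometries of $E$; an orthogonal representation of a (discrete) group $G$ on $E$ is a homomorphism $G\to\mathbf O(E)$. A unitary representation is a homomorphism from $G$ to the group of surjective linear isometries of a complex Hilbert space $\mathcal H$, and $\mathcal H^\pi$ is its subspace of invariant vectors. For a finite $S\subset G$ and $\varepsilon\ge 0$, $(S,\varepsilon)$ is a Kazhdan pair if for every unitary representation $\pi$ of $G$ on a Hilbert space $\mathcal H$, $$\max_{g\in S}\|\pi(g)\xi-\xi\|\ge\varepsilon\|\xi\|\quad\text{for all }\xi\in(\mathcal H^\pi)^\perp .$$ $G$ has Property (T) if it is finitely generated and has a Kazhdan pair $(S,\varepsilon)$ with $S$ finite and $\varepsilon>0$. The Kazhdan constant is $\kappa(S)=\sup\{\varepsilon\ge0 : (S,\varepsilon)\text{ is a Kazhdan pair for }G\}\in[0,\infty]$. A maximum over the empty set is $0$, and $\infty\cdot 0=0$ (these conventions matter only for the trivial group). Proposition. Let $(X,\mu)$ be a $\sigma$-finite measure space and $p\in[2,\infty)$. Let $G$ be a group with Property (T), and let $\pi:G\to\mathbf O(L^p(X,\mu))$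 be an orthogonal representation on the real Banach space $L^p(X,\mu)$ without nonzero invariant vectors. Then, for every finite generating subset $S\subset G$, $$\max_{g\in S}\|\pi(g)\xi-\xi\|_p\ \ge\ \frac{2\kappa(S)}{p}\,\|\xi\|_p\qquad\text{for all }\xi\in L^p(X,\mu).$$ -/

import Mathlib

open scoped ENNReal NNReal

universe u v

/-- The subspace of invariant vectors of an isometric representation `π` of `G` on `E`, that is, of
a group homomorphism from `G` to the group of (surjective) linear isometries of `E`. For `𝕜 = ℝ`
these representations are the orthogonal ones, and for a complex Hilbert space `E` the unitary
ones. -/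
def invariantVectors {𝕜 G E : Type*} [NormedField 𝕜] [Group G] [NormedAddCommGroup E]
    [NormedSpace 𝕜 E] (π : G →* (E ≃ₗᵢ[𝕜] E)) : Submodule 𝕜 E where
  carrier := {ξ | ∀ g : G, π g ξ = ξ}
  add_mem' := by
    intro a b ha hb g
    rw [map_add, ha g, hb g]
  zero_mem' := fun g => map_zero (π g)
  smul_mem' := by
    intro c a ha g
    rw [map_smul, ha g]

/-- `(S, ε)` is a Kazhdan pair for `G`: for every unitary representation `π` of `G` on a complex
Hilbert space `H`, `max_{g ∈ S} ‖π(g)ξ - ξ‖ ≥ ε ‖ξ‖` for all `ξ` in the orthogonal complement of the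
invariant vectors. The maximum over the empty set is `0`.

The Hilbert spaces range over an arbitrary universe `v`. For finitely generated `G` the notion does
not depend on `v`: the closed linear span of the orbit of a vector is then separable, hence
isomorphic to a Hilbert space in `Type`. -/
def IsKazhdanPair {G : Type u} [Group G] (S : Finset G) (ε : ℝ≥0) : Prop :=
  ∀ (H : Type v) [NormedAddCommGroup H] [InnerProductSpace ℂ H] [CompleteSpace H]
    (π : G →* (H ≃ₗᵢ[ℂ] H)), ∀ ξ ∈ (invariantVectors π)ᗮ,
      ε * ‖ξ‖₊ ≤ S.sup fun g => ‖π g ξ - ξ‖₊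

/-- Property (T) for a (discrete) group: it is finitely generated and has a Kazhdan pair `(S, ε)`
with `S` finite and `ε > 0`. -/
def HasPropertyT (G : Type u) [Group G] : Prop :=
  Group.FG G ∧ ∃ (S : Finset G) (ε : ℝ≥0), 0 < ε ∧ IsKazhdanPair.{u, v} S ε

/-- The Kazhdan constant `κ(S)`, the supremum of all `ε ≥ 0` such that `(S, ε)` is a Kazhdan pair.
It is taken in `[0, ∞]`, because for the trivial group every `ε` qualifies. -/
noncomputable def kazhdanConstant {G : Type u} [Group G] (S : Finset G) : ℝ≥0∞ :=
  ⨆ (ε : ℝ≥0) (_ : IsKazhdanPair.{u, v} S ε), (ε : ℝ≥0∞)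

/-! The Mazur map `M f = sign(f) |f|^(p/2)` carries `L^p` bijectively onto `L²`, with `‖M f‖ =
‖f‖^(p/2)`. It is not linear, yet conjugation by it turns every linear isometry `U` of `L^p` into a
linear isometry of `L²`. For `p = 2` the map `M` is the identity. For `p > 2`, equality in
Clarkson's inequality characterizes disjointness of supports by norms alone, so `U` preserves
disjointness (`LinearIsometryEquiv.map_disjoint`). Since `M` and its inverse are additive on
disjointly supported functions, so is the conjugate of `U`; it is also homogeneous and continuous,
hence additive on simple functions and, by density, everywhere (`map_add_of_map_add_disjoint`). The
full Banach–Lamperti description of isometries is not needed.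

The conjugated representation again has no nonzero invariant vectors. After complexification a
Kazhdan pair gives `ε ‖M ξ‖ ≤ max ‖M (π g ξ) - M ξ‖`. On the ball of radius `r` the map `M` is
Lipschitz with constant `(p/2) r^(p/2 - 1)` (`norm_mazurMap_sub_le`). Taking `r = ‖ξ‖` and
cancelling `‖ξ‖^(p/2 - 1)` leaves `ε ‖ξ‖ ≤ (p/2) max ‖π g ξ - ξ‖`. -/

open MeasureTheory

/-! ### Signed powers on the real line -/

/-- The odd extension `x ↦ sign(x) |x| ^ s` of the power function. -/
noncomputable def signedRpow (s x : ℝ) : ℝ := x * |x| ^ (s - 1)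

theorem abs_signedRpow {s : ℝ} (hs : 0 < s) (x : ℝ) : |signedRpow s x| = |x| ^ s := by
  unfold signedRpow
  rcases eq_or_ne x 0 with rfl | hx
  · simp [Real.zero_rpow hs.ne']
  · rw [abs_mul, abs_of_nonneg (Real.rpow_nonneg (abs_nonneg x) _),
      Real.rpow_sub_one (abs_ne_zero.2 hx), mul_div_cancel₀ _ (abs_ne_zero.2 hx)]

theorem signedRpow_of_nonneg {s : ℝ} (hs : 0 < s) {x : ℝ} (hx : 0 ≤ x) :
    signedRpow s x = x ^ s := by
  have h : 0 ≤ signedRpow s x := mul_nonneg hx (Real.rpow_nonneg (abs_nonneg x) _)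
  rw [← abs_of_nonneg h, abs_signedRpow hs, abs_of_nonneg hx]

@[simp] theorem signedRpow_zero (s : ℝ) : signedRpow s 0 = 0 := by simp [signedRpow]

@[simp] theorem signedRpow_one (x : ℝ) : signedRpow 1 x = x := by simp [signedRpow]

theorem signedRpow_neg (s x : ℝ) : signedRpow s (-x) = -signedRpow s x := by simp [signedRpow]

theorem signedRpow_mul (s x y : ℝ) :
    signedRpow s (x * y) = signedRpow s x * signedRpow s y := by
  unfold signedRpow
  rw [abs_mul, Real.mul_rpow (abs_nonneg x) (abs_nonneg y)]
  ring

theorem signedRpow_signedRpow {s t : ℝ} (hs : 0 < s) (hst : t * s = 1) (x : ℝ) :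
    signedRpow t (signedRpow s x) = x := by
  rcases eq_or_ne x 0 with rfl | hx
  · simp
  · rw [signedRpow, abs_signedRpow hs, signedRpow, mul_assoc, ← Real.rpow_mul (abs_nonneg x),
      ← Real.rpow_add (abs_pos.2 hx)]
    have : s - 1 + s * (t - 1) = 0 := by linarith
    rw [this, Real.rpow_zero, mul_one]

theorem measurable_signedRpow (s : ℝ) : Measurable (signedRpow s) := by
  unfold signedRpow
  fun_prop

/-- Bernoulli's inequality at `b / a`: the convex function `x ^ s` lies above its tangent at `a`. -/
theorem rpow_sub_rpow_le {s a b : ℝ} (hs : 1 ≤ s) (hb : 0 ≤ b) (hab : b ≤ a) :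
    a ^ s - b ^ s ≤ s * (a - b) * a ^ (s - 1) := by
  rcases eq_or_lt_of_le (hb.trans hab) with h | ha
  · obtain rfl : b = a := by linarith
    simp
  · have hba : 0 ≤ b / a := by positivity
    have h := one_add_mul_self_le_rpow_one_add (s := b / a - 1) (by linarith) hs
    rw [add_sub_cancel, Real.div_rpow hb ha.le, le_div_iff₀ (by positivity)] at h
    have h2 : a ^ s = a * a ^ (s - 1) := by
      rw [Real.rpow_sub_one ha.ne', mul_div_cancel₀ _ ha.ne']
    have h3 : (1 + s * (b / a - 1)) * a ^ s = a ^ s - s * (a - b) * a ^ (s - 1) := by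
      rw [h2]; field_simp; ring
    linarith

theorem abs_signedRpow_sub_le {s : ℝ} (hs : 1 ≤ s) (a b : ℝ) :
    |signedRpow s a - signedRpow s b| ≤ s * |a - b| * max |a| |b| ^ (s - 1) := by
  have hs0 : 0 < s := by linarith
  wlog hba : |b| ≤ |a| generalizing a b
  · rw [abs_sub_comm, abs_sub_comm a, max_comm]
    exact this b a (le_of_not_ge hba)
  wlog ha : 0 ≤ a generalizing a b
  · have := this (-a) (-b) (by simpa using hba) (by linarith)
    rw [signedRpow_neg, signedRpow_neg, abs_neg, abs_neg] at this
    convert this using 1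
    · rw [← abs_neg]; congr 1; ring
    · rw [← abs_neg (a - b)]; congr 3; ring
  rw [max_eq_left hba]
  rw [abs_of_nonneg ha] at hba ⊢
  rw [signedRpow_of_nonneg hs0 ha]
  rcases le_total 0 b with hb | hb
  · rw [abs_of_nonneg hb] at hba
    rw [signedRpow_of_nonneg hs0 hb, abs_of_nonneg (sub_nonneg.2 hba),
      abs_of_nonneg (sub_nonneg.2 (Real.rpow_le_rpow hb hba hs0.le))]
    exact rpow_sub_rpow_le hs hb hba
  · rw [abs_of_nonneg (by linarith : 0 ≤ a - b), ← neg_neg b, signedRpow_neg,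
      signedRpow_of_nonneg hs0 (by linarith : 0 ≤ -b)]
    rw [abs_of_nonpos hb] at hba
    set c := -b
    have hc : 0 ≤ c := by simp only [c]; linarith
    -- For opposite signs the difference is a sum of two powers, and each is at most its base times
    -- the larger factor `a ^ (s - 1)`.
    have key : ∀ x : ℝ, 0 ≤ x → x ≤ a → x ^ s ≤ x * a ^ (s - 1) := by
      intro x hx hxa
      have h := abs_signedRpow hs0 x
      rw [signedRpow, abs_mul, abs_of_nonneg (Real.rpow_nonneg (abs_nonneg x) _),
        abs_of_nonneg hx] at h
      rw [← h]
      exact mul_le_mul_of_nonneg_left (Real.rpow_le_rpow hx hxa (by linarith)) hx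
    have h1 := key a ha le_rfl
    have h2 := key c hc hba
    have h3 : 0 ≤ a ^ (s - 1) := Real.rpow_nonneg ha _
    rw [sub_neg_eq_add, sub_neg_eq_add, abs_of_nonneg (by positivity)]
    calc a ^ s + c ^ s ≤ 1 * ((a + c) * a ^ (s - 1)) := by linarith
      _ ≤ s * ((a + c) * a ^ (s - 1)) := by gcongr
      _ = _ := by ring

/-- For equal signs this is subadditivity of `t ^ s`, even with constant 1. For opposite signs both
`|a|` and `|b|` are at most `|a - b|`, whence the 2. The constant is immaterial: the bound serves
only for continuity. -/
theorem abs_signedRpow_sub_le_rpow {s : ℝ} (hs0 : 0 < s) (hs : s ≤ 1) (a b : ℝ) :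
    |signedRpow s a - signedRpow s b| ≤ 2 * |a - b| ^ s := by
  wlog hba : b ≤ a generalizing a b
  · rw [abs_sub_comm, abs_sub_comm a]
    exact this b a (le_of_not_ge hba)
  have key : ∀ x y : ℝ, 0 ≤ x → x ≤ y →
      |signedRpow s y - signedRpow s x| ≤ 2 * |y - x| ^ s := by
    intro x y hx hxy
    have hy := hx.trans hxy
    rw [signedRpow_of_nonneg hs0 hx, signedRpow_of_nonneg hs0 hy,
      abs_of_nonneg (sub_nonneg.2 hxy),
      abs_of_nonneg (sub_nonneg.2 (Real.rpow_le_rpow hx hxy hs0.le))]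
    have h := Real.rpow_add_le_add_rpow hx (sub_nonneg.2 hxy) hs0.le hs
    rw [add_sub_cancel] at h
    have := Real.rpow_nonneg (sub_nonneg.2 hxy) s
    linarith
  rcases le_total 0 b with hb | hb
  · exact key b a hb hba
  rcases le_total a 0 with ha | ha
  · have := key (-a) (-b) (by linarith) (by linarith)
    rwa [signedRpow_neg, signedRpow_neg, neg_sub_neg, neg_sub_neg] at this
  · have h1 := abs_signedRpow hs0 a
    have h2 := abs_signedRpow hs0 b
    have h3 : |a| ^ s ≤ |a - b| ^ s :=
      Real.rpow_le_rpow (abs_nonneg _) (abs_le_abs (by linarith) (by linarith)) hs0.le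
    have h4 : |b| ^ s ≤ |a - b| ^ s := by
      refine Real.rpow_le_rpow (abs_nonneg _) ?_ hs0.le
      rw [abs_of_nonpos hb, abs_of_nonneg (by linarith)]
      linarith
    have h5 := abs_sub (signedRpow s a) (signedRpow s b)
    linarith

/-! ### Clarkson's inequality for real numbers and its equality case -/

theorem add_rpow_lt_rpow_add {t u v : ℝ} (ht : 1 < t) (hu : 0 < u) (hv : 0 < v) :
    u ^ t + v ^ t < (u + v) ^ t := by
  have h : ∀ x : ℝ, 0 < x → x ^ t = x * x ^ (t - 1) := fun x hx => by
    rw [Real.rpow_sub_one hx.ne', mul_div_cancel₀ _ hx.ne']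
  rw [h u hu, h v hv, h (u + v) (by positivity), add_mul]
  have ht' : 0 < t - 1 := by linarith
  have h1 : u ^ (t - 1) < (u + v) ^ (t - 1) := Real.rpow_lt_rpow hu.le (by linarith) ht'
  have h2 : v ^ (t - 1) < (u + v) ^ (t - 1) := Real.rpow_lt_rpow hv.le (by linarith) ht'
  gcongr

theorem abs_rpow_eq_sq_rpow (q x : ℝ) : |x| ^ q = (x ^ 2) ^ (q / 2) := by
  rw [← sq_abs x, ← Real.rpow_natCast, ← Real.rpow_mul (abs_nonneg x)]
  congr 1
  push_cast
  ring

/-- Convexity of `t ^ (q / 2)` at the points `(x + y) ^ 2` and `(x - y) ^ 2`, whose midpoint is `x ^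
2 + y ^ 2`. -/
theorem two_mul_sq_add_sq_rpow_le {q : ℝ} (hq : 2 < q) (x y : ℝ) :
    2 * (x ^ 2 + y ^ 2) ^ (q / 2) ≤ |x + y| ^ q + |x - y| ^ q := by
  have h := (convexOn_rpow (p := q / 2) (by linarith)).2 (Set.mem_Ici.2 (sq_nonneg (x + y)))
    (Set.mem_Ici.2 (sq_nonneg (x - y))) (by norm_num : (0 : ℝ) ≤ 1 / 2)
    (by norm_num : (0 : ℝ) ≤ 1 / 2) (by norm_num)
  simp only [smul_eq_mul] at h
  rw [← abs_rpow_eq_sq_rpow, ← abs_rpow_eq_sq_rpow] at h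
  have : 1 / 2 * (x + y) ^ 2 + 1 / 2 * (x - y) ^ 2 = x ^ 2 + y ^ 2 := by ring
  rw [this] at h
  linarith

/-- A pointwise Clarkson inequality. -/
theorem two_mul_abs_rpow_add_le {q : ℝ} (hq : 2 < q) (x y : ℝ) :
    2 * (|x| ^ q + |y| ^ q) ≤ |x + y| ^ q + |x - y| ^ q := by
  have h := two_mul_sq_add_sq_rpow_le hq x y
  have h2 := Real.add_rpow_le_rpow_add (sq_nonneg x) (sq_nonneg y) (p := q / 2) (by linarith)
  rw [← abs_rpow_eq_sq_rpow, ← abs_rpow_eq_sq_rpow] at h2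
  linarith

/-- Clarkson's inequality is convexity followed by superadditivity of `t ^ (q / 2)`, and the latter
is strict when both terms are positive because `q / 2 > 1`. -/
theorem abs_rpow_add_eq_iff {q : ℝ} (hq : 2 < q) (x y : ℝ) :
    |x + y| ^ q + |x - y| ^ q = 2 * (|x| ^ q + |y| ^ q) ↔ x = 0 ∨ y = 0 := by
  constructor
  · intro h
    by_contra! hxy
    have h1 := two_mul_sq_add_sq_rpow_le hq x y
    have h2 := add_rpow_lt_rpow_add (t := q / 2) (by linarith) (pow_pos (abs_pos.2 hxy.1) 2)
      (pow_pos (abs_pos.2 hxy.2) 2)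
    rw [sq_abs, sq_abs, ← abs_rpow_eq_sq_rpow, ← abs_rpow_eq_sq_rpow] at h2
    linarith
  · have hq' : q ≠ 0 := by linarith
    rintro (rfl | rfl)
    · simp [Real.zero_rpow hq']; ring
    · simp [Real.zero_rpow hq']; ring

/-! ### The Mazur map: norm, homogeneity, disjointness and Lipschitz bounds -/

theorem mul_ofReal_toReal_div_toReal {p q : ℝ≥0∞} (hp : 0 < p.toReal) (hq : 0 < q.toReal) :
    q * ENNReal.ofReal (p.toReal / q.toReal) = p := by
  have hp' := (ENNReal.toReal_pos_iff.1 hp).2.ne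
  have hq' := (ENNReal.toReal_pos_iff.1 hq).2.ne
  rw [← ENNReal.ofReal_toReal hp', ← ENNReal.ofReal_toReal hq', ← ENNReal.ofReal_mul (by simp)]
  congr 1
  simp only [ENNReal.toReal_ofReal hp.le, ENNReal.toReal_ofReal hq.le]
  field_simp

section MazurMap

variable {X : Type*} [MeasurableSpace X] {μ : Measure X} {p q : ℝ≥0∞}

theorem eLpNorm_signedRpow (hp : 0 < p.toReal) (hq : 0 < q.toReal) (f : X → ℝ) :
    eLpNorm (fun x => signedRpow (p.toReal / q.toReal) (f x)) q μ =
      eLpNorm f p μ ^ (p.toReal / q.toReal) := by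
  have hs : 0 < p.toReal / q.toReal := by positivity
  have h : eLpNorm (fun x => signedRpow (p.toReal / q.toReal) (f x)) q μ =
      eLpNorm (fun x => ‖f x‖ ^ (p.toReal / q.toReal)) q μ := by
    refine eLpNorm_congr_norm_ae (.of_forall fun x => ?_)
    rw [Real.norm_eq_abs, abs_signedRpow hs, Real.norm_eq_abs, Real.norm_eq_abs,
      abs_of_nonneg (Real.rpow_nonneg (abs_nonneg _) _)]
  rw [h, eLpNorm_norm_rpow f hs, mul_ofReal_toReal_div_toReal hp hq]

theorem memLp_signedRpow (hp : 0 < p.toReal) (hq : 0 < q.toReal) {f : X → ℝ} (hf : MemLp f p μ) :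
    MemLp (fun x => signedRpow (p.toReal / q.toReal) (f x)) q μ := by
  refine ⟨((measurable_signedRpow _).comp_aemeasurable hf.1.aemeasurable).aestronglyMeasurable, ?_⟩
  rw [eLpNorm_signedRpow hp hq]
  exact ENNReal.rpow_lt_top_of_nonneg (by positivity) hf.2.ne

/-- The Mazur map `f ↦ sign(f) |f| ^ (p / q)` from `L^p` to `L^q`. -/
noncomputable def mazurMap (hp : 0 < p.toReal) (hq : 0 < q.toReal) (f : Lp ℝ p μ) : Lp ℝ q μ :=
  (memLp_signedRpow hp hq (Lp.memLp f)).toLp _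

variable (hp : 0 < p.toReal) (hq : 0 < q.toReal)

theorem coeFn_mazurMap (f : Lp ℝ p μ) :
    mazurMap hp hq f =ᵐ[μ] fun x => signedRpow (p.toReal / q.toReal) (f x) :=
  MemLp.coeFn_toLp _

theorem mazurMap_mazurMap (f : Lp ℝ p μ) : mazurMap hq hp (mazurMap hp hq f) = f := by
  refine Lp.ext ?_
  filter_upwards [coeFn_mazurMap hq hp (mazurMap hp hq f), coeFn_mazurMap hp hq f] with x h1 h2
  rw [h1, h2, signedRpow_signedRpow (by positivity)]
  field_simp

theorem norm_mazurMap (f : Lp ℝ p μ) :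
    ‖mazurMap hp hq f‖ = ‖f‖ ^ (p.toReal / q.toReal) := by
  rw [Lp.norm_def, eLpNorm_congr_ae (coeFn_mazurMap hp hq f), eLpNorm_signedRpow hp hq,
    Lp.norm_def, ENNReal.toReal_rpow]

theorem mazurMap_smul (c : ℝ) (f : Lp ℝ p μ) :
    mazurMap hp hq (c • f) = signedRpow (p.toReal / q.toReal) c • mazurMap hp hq f := by
  refine Lp.ext ?_
  filter_upwards [coeFn_mazurMap hp hq (c • f), coeFn_mazurMap hp hq f, Lp.coeFn_smul c f,
    Lp.coeFn_smul (signedRpow (p.toReal / q.toReal) c) (mazurMap hp hq f)] with x h1 h2 h3 h4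
  rw [h1, h3, h4, Pi.smul_apply, Pi.smul_apply, h2, smul_eq_mul, smul_eq_mul, signedRpow_mul]

theorem mazurMap_add_of_disjoint {f g : Lp ℝ p μ} (h : ∀ᵐ x ∂μ, f x = 0 ∨ g x = 0) :
    mazurMap hp hq (f + g) = mazurMap hp hq f + mazurMap hp hq g := by
  refine Lp.ext ?_
  filter_upwards [h, coeFn_mazurMap hp hq (f + g), coeFn_mazurMap hp hq f, coeFn_mazurMap hp hq g,
    Lp.coeFn_add f g, Lp.coeFn_add (mazurMap hp hq f) (mazurMap hp hq g)] with x h h1 h2 h3 h4 h5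
  rw [h1, h4, h5, Pi.add_apply, Pi.add_apply, h2, h3]
  rcases h with h | h <;> simp [h]

theorem mazurMap_disjoint {f g : Lp ℝ p μ} (h : ∀ᵐ x ∂μ, f x = 0 ∨ g x = 0) :
    ∀ᵐ x ∂μ, mazurMap hp hq f x = 0 ∨ mazurMap hp hq g x = 0 := by
  filter_upwards [h, coeFn_mazurMap hp hq f, coeFn_mazurMap hp hq g] with x h h1 h2
  rw [h1, h2]
  exact h.imp (by simp +contextual) (by simp +contextual)

theorem norm_mazurMap_sub_le_rpow (hpq : p.toReal ≤ q.toReal) (f g : Lp ℝ p μ) :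
    ‖mazurMap hp hq f - mazurMap hp hq g‖ ≤ 2 * ‖f - g‖ ^ (p.toReal / q.toReal) := by
  have hs : 0 < p.toReal / q.toReal := by positivity
  rw [← norm_mazurMap hp hq]
  refine Lp.norm_le_mul_norm_of_ae_le_mul ?_
  filter_upwards [coeFn_mazurMap hp hq f, coeFn_mazurMap hp hq g, coeFn_mazurMap hp hq (f - g),
    Lp.coeFn_sub f g, Lp.coeFn_sub (mazurMap hp hq f) (mazurMap hp hq g)] with x h1 h2 h3 h4 h5
  rw [h5, h3, h4, Pi.sub_apply, Pi.sub_apply, h1, h2, Real.norm_eq_abs, Real.norm_eq_abs,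
    abs_signedRpow hs]
  exact abs_signedRpow_sub_le_rpow hs ((div_le_one hq).2 hpq) _ _

theorem continuous_mazurMap_of_le [Fact (1 ≤ p)] [Fact (1 ≤ q)] (hpq : p.toReal ≤ q.toReal) :
    Continuous (mazurMap (μ := μ) hp hq) := by
  have hs : 0 < p.toReal / q.toReal := by positivity
  refine continuous_iff_continuousAt.2 fun f => tendsto_iff_norm_sub_tendsto_zero.2 ?_
  refine squeeze_zero (fun _ => norm_nonneg _)
    (fun g => norm_mazurMap_sub_le_rpow hp hq hpq g f) ?_
  have hc : Continuous fun g : Lp ℝ p μ => 2 * ‖g - f‖ ^ (p.toReal / q.toReal) :=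
    continuous_const.mul ((continuous_id.sub continuous_const).norm.rpow_const fun _ => .inr hs.le)
  simpa [Real.zero_rpow hs.ne'] using hc.tendsto f

/-- The pointwise mean value bound with `max |f| |g| ≤ |f| + |f - g|`, then Hölder with `1/q = 1/p +
(s - 1)/p` and Minkowski. The extra `‖f - g‖` in the base is a second-order loss, removed in
`norm_mazurMap_sub_le` by subdivision. -/
theorem norm_mazurMap_sub_le_aux [Fact (1 ≤ p)] (hpq : q.toReal ≤ p.toReal) (f g : Lp ℝ p μ) :
    ‖mazurMap hp hq f - mazurMap hp hq g‖ ≤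
      p.toReal / q.toReal * ‖f - g‖ * (‖f‖ + ‖f - g‖) ^ (p.toReal / q.toReal - 1) := by
  set s := p.toReal / q.toReal with hs
  have hs1 : 1 ≤ s := (one_le_div hq).2 hpq
  have hp' := (ENNReal.toReal_pos_iff.1 hp).2.ne
  have hq' := (ENNReal.toReal_pos_iff.1 hq).2.ne
  let h : X → ℝ := fun x => ‖f x‖ + ‖(f - g) x‖
  have hh : MemLp h p μ := (Lp.memLp f).norm.add (Lp.memLp (f - g)).norm
  have hbound : ∀ᵐ x ∂μ, ‖(mazurMap hp hq f - mazurMap hp hq g) x‖ ≤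
      s * ‖(f - g) x * ‖h x‖ ^ (s - 1)‖ := by
    filter_upwards [coeFn_mazurMap hp hq f, coeFn_mazurMap hp hq g, Lp.coeFn_sub f g,
      Lp.coeFn_sub (mazurMap hp hq f) (mazurMap hp hq g)] with x h1 h2 h3 h4
    have hx : max |f x| |g x| ≤ ‖h x‖ := by
      refine le_trans ?_ (le_abs_self _)
      simp only [h, h3, Pi.sub_apply, Real.norm_eq_abs]
      refine max_le (by linarith [abs_nonneg (f x - g x)]) ?_
      have := abs_sub (f x) (f x - g x)
      rwa [sub_sub_cancel] at this
    rw [h4, Pi.sub_apply, h1, h2, norm_mul, h3, Pi.sub_apply]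
    refine (abs_signedRpow_sub_le hs1 _ _).trans ?_
    rw [Real.norm_of_nonneg (Real.rpow_nonneg (norm_nonneg (h x)) _), mul_assoc, Real.norm_eq_abs]
    have : max |f x| |g x| ^ (s - 1) ≤ ‖h x‖ ^ (s - 1) :=
      Real.rpow_le_rpow (by positivity) hx (by linarith)
    gcongr
  have hholder : eLpNorm (fun x => (f - g) x * ‖h x‖ ^ (s - 1)) q μ ≤
      eLpNorm (f - g) p μ * eLpNorm h p μ ^ (s - 1) := by
    -- For `s = 1` the Hölder exponent `p / (s - 1)` should be `∞`, but division by zero would make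
    -- it 0; there `p = q` and no Hölder inequality is needed.
    rcases hs1.eq_or_lt with h1 | h1
    · have hpq' : p = q := by
        rw [← mul_ofReal_toReal_div_toReal hp hq, ← hs, ← h1]; simp
      simp only [← h1, sub_self, Real.rpow_zero, mul_one, ENNReal.rpow_zero, hpq']
      exact le_rfl
    · have hs' : 0 < s - 1 := by linarith
      let r : ℝ≥0∞ := ENNReal.ofReal (p.toReal / (s - 1))
      have hr : r * ENNReal.ofReal (s - 1) = p := by
        rw [← ENNReal.ofReal_mul (by positivity), div_mul_cancel₀ _ hs'.ne',
          ENNReal.ofReal_toReal hp']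
      have : ENNReal.HolderTriple p r q := by
        refine ⟨?_⟩
        rw [← ENNReal.ofReal_toReal hp', ← ENNReal.ofReal_toReal hq', ← ENNReal.ofReal_inv_of_pos hp,
          ← ENNReal.ofReal_inv_of_pos hq, ← ENNReal.ofReal_inv_of_pos (by positivity),
          ← ENNReal.ofReal_add (by positivity) (by positivity)]
        congr 1
        rw [hs]
        field_simp
        ring
      have := eLpNorm_smul_le_mul_eLpNorm (p := p) (q := r) (r := q) (μ := μ)
        (f := fun x => ‖h x‖ ^ (s - 1)) (φ := (f - g : Lp ℝ p μ))
        (hh.1.norm.aemeasurable.pow_const (s - 1)).aestronglyMeasurable (Lp.memLp (f - g)).1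
      rwa [eLpNorm_norm_rpow h hs', hr] at this
  have htri : eLpNorm h p μ ≤ eLpNorm f p μ + eLpNorm (f - g : Lp ℝ p μ) p μ := by
    have := eLpNorm_add_le (Lp.memLp f).1.norm (Lp.memLp (f - g)).1.norm (Fact.out : 1 ≤ p)
    rwa [eLpNorm_norm, eLpNorm_norm] at this
  have hfin : eLpNorm f p μ + eLpNorm (f - g : Lp ℝ p μ) p μ ≠ ∞ :=
    ENNReal.add_ne_top.2 ⟨(Lp.memLp f).2.ne, (Lp.memLp (f - g)).2.ne⟩
  have hall : eLpNorm (mazurMap hp hq f - mazurMap hp hq g : Lp ℝ q μ) q μ ≤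
      ENNReal.ofReal s * (eLpNorm (f - g : Lp ℝ p μ) p μ *
        (eLpNorm f p μ + eLpNorm (f - g : Lp ℝ p μ) p μ) ^ (s - 1)) := by
    refine (eLpNorm_le_mul_eLpNorm_of_ae_le_mul hbound q).trans ?_
    gcongr
    refine hholder.trans ?_
    gcongr
  have := ENNReal.toReal_mono (ENNReal.mul_ne_top ENNReal.ofReal_ne_top
    (ENNReal.mul_ne_top (Lp.memLp (f - g)).2.ne
      (ENNReal.rpow_ne_top_of_nonneg (by linarith) hfin))) hall
  rw [ENNReal.toReal_mul, ENNReal.toReal_mul, ← ENNReal.toReal_rpow, ENNReal.toReal_add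
    (Lp.memLp f).2.ne (Lp.memLp (f - g)).2.ne, ENNReal.toReal_ofReal (by linarith),
    ← Lp.norm_def, ← Lp.norm_def, ← Lp.norm_def, ← mul_assoc] at this
  exact this

/-- On balls, the Mazur map `L^p → L^q` with `q ≤ p` is Lipschitz, with the sharp constant. -/
theorem norm_mazurMap_sub_le [Fact (1 ≤ p)] [Fact (1 ≤ q)] (hpq : q.toReal ≤ p.toReal) {r : ℝ}
    {f g : Lp ℝ p μ} (hf : ‖f‖ ≤ r) (hg : ‖g‖ ≤ r) :
    ‖mazurMap hp hq f - mazurMap hp hq g‖ ≤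
      p.toReal / q.toReal * ‖f - g‖ * r ^ (p.toReal / q.toReal - 1) := by
  set s := p.toReal / q.toReal with hs
  have hs1 : 1 ≤ s := (one_le_div hq).2 hpq
  have hr : 0 ≤ r := (norm_nonneg f).trans hf
  -- Cut the segment from `f` to `g` into `n + 1` equal pieces. By convexity every division point
  -- stays in the ball, so the crude bound on each piece exceeds `r` in the base only by `‖f - g‖ /
  -- (n + 1)`, which vanishes in the limit.
  have key : ∀ n : ℕ, ‖mazurMap hp hq f - mazurMap hp hq g‖ ≤
      s * ‖f - g‖ * (r + ‖f - g‖ / ((n : ℝ) + 1)) ^ (s - 1) := by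
    intro n
    have hn : (0 : ℝ) < (n : ℝ) + 1 := by positivity
    let a : ℕ → Lp ℝ p μ := fun k => f + ((k : ℝ) / ((n : ℝ) + 1)) • (g - f)
    have hstep : ∀ k, a k - a (k + 1) = (1 / ((n : ℝ) + 1)) • (f - g) := by
      intro k
      simp only [a]
      push_cast
      module
    have hstep' : ∀ k, ‖a k - a (k + 1)‖ = ‖f - g‖ / ((n : ℝ) + 1) := by
      intro k
      rw [hstep, norm_smul, Real.norm_of_nonneg (by positivity)]
      ring
    have ha : ∀ k < n + 1, ‖a k‖ ≤ r := by
      intro k hk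
      have hk' : (k : ℝ) / ((n : ℝ) + 1) ≤ 1 := by
        rw [div_le_one hn]
        exact_mod_cast hk.le
      have := (convex_closedBall (0 : Lp ℝ p μ) r).add_smul_sub_mem (x := f) (y := g)
        (by simpa using hf) (by simpa using hg) ⟨by positivity, hk'⟩
      simpa using this
    have := dist_le_range_sum_of_dist_le (f := fun k => mazurMap hp hq (a k))
      (d := fun _ => s * (‖f - g‖ / ((n : ℝ) + 1)) * (r + ‖f - g‖ / ((n : ℝ) + 1)) ^ (s - 1))
      (n + 1) (fun {k} hk => by
        rw [dist_eq_norm]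
        refine (norm_mazurMap_sub_le_aux hp hq hpq _ _).trans ?_
        rw [hstep', ← hs]
        have := ha k hk
        gcongr)
    rw [Finset.sum_const, Finset.card_range, nsmul_eq_mul, dist_eq_norm] at this
    have h0 : a 0 = f := by simp [a]
    have h1 : a (n + 1) = g := by
      simp only [a]
      push_cast
      rw [div_self hn.ne']
      module
    rw [h0, h1] at this
    refine this.trans_eq ?_
    push_cast
    field_simp
  refine ge_of_tendsto' (x := Filter.atTop) ?_ key
  have h1 : Filter.Tendsto (fun n : ℕ => r + ‖f - g‖ / ((n : ℝ) + 1)) Filter.atTop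
      (nhds (r + 0)) := by
    refine tendsto_const_nhds.add ?_
    have := (tendsto_one_div_add_atTop_nhds_zero_nat (𝕜 := ℝ)).const_mul ‖f - g‖
    simpa [div_eq_mul_inv] using this
  rw [add_zero] at h1
  exact (h1.rpow_const (.inr (by linarith))).const_mul _

theorem continuous_mazurMap_of_ge [Fact (1 ≤ p)] [Fact (1 ≤ q)] (hpq : q.toReal ≤ p.toReal) :
    Continuous (mazurMap (μ := μ) hp hq) := by
  have hs : 0 ≤ p.toReal / q.toReal - 1 := sub_nonneg.2 ((one_le_div hq).2 hpq)
  refine continuous_iff_continuousAt.2 fun f => tendsto_iff_norm_sub_tendsto_zero.2 ?_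
  refine squeeze_zero (fun _ => norm_nonneg _)
    (fun g => norm_mazurMap_sub_le_aux hp hq hpq g f) ?_
  have hc : Continuous fun g : Lp ℝ p μ =>
      p.toReal / q.toReal * ‖g - f‖ * (‖g‖ + ‖g - f‖) ^ (p.toReal / q.toReal - 1) :=
    (continuous_const.mul (continuous_id.sub continuous_const).norm).mul
      ((continuous_norm.add (continuous_id.sub continuous_const).norm).rpow_const fun _ => .inr hs)
  simpa using hc.tendsto f

end MazurMap

/-! ### Isometries preserve disjointness; linearity of the Mazur conjugate -/

section Lamperti

variable {X Y : Type*} [MeasurableSpace X] [MeasurableSpace Y] {μ : Measure X} {ν : Measure Y}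
  {p q : ℝ≥0∞}

theorem integrable_abs_rpow_coeFn (hp : 0 < p.toReal) (f : Lp ℝ p μ) :
    Integrable (fun x => |f x| ^ p.toReal) μ :=
  (Lp.memLp f).integrable_norm_rpow (by rintro rfl; simp at hp) (by rintro rfl; simp at hp)

theorem norm_rpow_eq_integral {E : Type*} [NormedAddCommGroup E] (hp : 0 < p.toReal)
    (f : Lp E p μ) : ‖f‖ ^ p.toReal = ∫ x, ‖f x‖ ^ p.toReal ∂μ := by
  have h0 : 0 ≤ ∫ x, ‖f x‖ ^ p.toReal ∂μ := integral_nonneg fun x => by positivity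
  rw [Lp.norm_def, (Lp.memLp f).eLpNorm_eq_integral_rpow_norm (by rintro rfl; simp at hp)
    (by rintro rfl; simp at hp), ENNReal.toReal_ofReal (by positivity),
    ← Real.rpow_mul h0, inv_mul_cancel₀ hp.ne', Real.rpow_one]

/-- The equality case of Clarkson's inequality: for `p > 2` it characterizes disjointness of
supports. -/
theorem norm_rpow_add_eq_iff_disjoint (hp : 2 < p.toReal) (f g : Lp ℝ p μ) :
    ‖f + g‖ ^ p.toReal + ‖f - g‖ ^ p.toReal = 2 * (‖f‖ ^ p.toReal + ‖g‖ ^ p.toReal) ↔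
      ∀ᵐ x ∂μ, f x = 0 ∨ g x = 0 := by
  have hp0 : 0 < p.toReal := by linarith
  have hi := integrable_abs_rpow_coeFn (μ := μ) hp0
  simp only [norm_rpow_eq_integral hp0, Real.norm_eq_abs]
  rw [← integral_add (hi _) (hi _), ← integral_add (hi _) (hi _), ← integral_const_mul, eq_comm]
  -- As one integrand dominates the other almost everywhere, equal integrals mean almost everywhere
  -- equal integrands.
  refine (integral_eq_iff_of_ae_le (((hi f).add (hi g)).const_mul 2) ((hi _).add (hi _)) ?_).trans ?_
  rotate_left
  · constructor
    · intro h
      filter_upwards [h, Lp.coeFn_add f g, Lp.coeFn_sub f g] with x h h1 h2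
      simp only [Pi.add_apply] at h
      rw [h1, h2] at h
      exact (abs_rpow_add_eq_iff hp _ _).1 h.symm
    · intro h
      filter_upwards [h, Lp.coeFn_add f g, Lp.coeFn_sub f g] with x h h1 h2
      simp only [Pi.add_apply]
      rw [h1, h2]
      exact ((abs_rpow_add_eq_iff hp _ _).2 h).symm
  · filter_upwards [Lp.coeFn_add f g, Lp.coeFn_sub f g] with x h1 h2
    simp only [Pi.add_apply]
    rw [h1, h2]
    exact two_mul_abs_rpow_add_le hp _ _

/-- For `p > 2`, linear isometries between `L^p` spaces preserve disjointness of supports. -/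
theorem LinearIsometryEquiv.map_disjoint [Fact (1 ≤ p)] (hp : 2 < p.toReal)
    (U : Lp ℝ p μ ≃ₗᵢ[ℝ] Lp ℝ p ν) {f g : Lp ℝ p μ} (h : ∀ᵐ x ∂μ, f x = 0 ∨ g x = 0) :
    ∀ᵐ x ∂ν, U f x = 0 ∨ U g x = 0 := by
  rw [← norm_rpow_add_eq_iff_disjoint hp] at h ⊢
  rwa [← map_add, ← map_sub, U.norm_map, U.norm_map, U.norm_map, U.norm_map]

theorem ae_disjoint_sum {ι : Type*} (t : Finset ι) (f : Lp ℝ p μ) (F : ι → Lp ℝ p μ)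
    (h : ∀ i ∈ t, ∀ᵐ x ∂μ, f x = 0 ∨ F i x = 0) :
    ∀ᵐ x ∂μ, f x = 0 ∨ (∑ i ∈ t, F i : Lp ℝ p μ) x = 0 := by
  classical
  induction t using Finset.induction_on with
  | empty =>
    filter_upwards [Lp.coeFn_zero ℝ p μ] with x hx
    right
    rw [Finset.sum_empty, hx, Pi.zero_apply]
  | insert a t ha ih =>
    filter_upwards [ih fun i hi => h i (Finset.mem_insert_of_mem hi),
      h a (Finset.mem_insert_self a t), Lp.coeFn_add (F a) (∑ i ∈ t, F i)] with x h1 h2 h3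
    rw [Finset.sum_insert ha, h3, Pi.add_apply]
    rcases h1 with h1 | h1
    · exact .inl h1
    · exact h2.imp id fun h2 => by rw [h1, h2, add_zero]

theorem map_sum_of_disjoint {ι E : Type*} [AddCommMonoid E] {T : Lp ℝ p μ → E} (h0 : T 0 = 0)
    (hadd : ∀ f g : Lp ℝ p μ, (∀ᵐ x ∂μ, f x = 0 ∨ g x = 0) → T (f + g) = T f + T g)
    (t : Finset ι) (F : ι → Lp ℝ p μ)
    (h : ∀ i ∈ t, ∀ j ∈ t, i ≠ j → ∀ᵐ x ∂μ, F i x = 0 ∨ F j x = 0) :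
    T (∑ i ∈ t, F i) = ∑ i ∈ t, T (F i) := by
  classical
  induction t using Finset.induction_on with
  | empty => simpa using h0
  | insert a t ha ih =>
    rw [Finset.sum_insert ha, Finset.sum_insert ha, hadd, ih]
    · exact fun i hi j hj => h i (Finset.mem_insert_of_mem hi) j (Finset.mem_insert_of_mem hj)
    · exact ae_disjoint_sum t _ _ fun i hi => h a (Finset.mem_insert_self a t) i
        (Finset.mem_insert_of_mem hi) (by rintro rfl; exact ha hi)

theorem coeFn_sum_smul_indicator {ι : Type*} (t : Finset ι) (c : ι → ℝ) (A : ι → Set X)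
    (e : ι → Lp ℝ p μ) (he : ∀ i ∈ t, e i =ᵐ[μ] (A i).indicator 1) :
    (∑ i ∈ t, c i • e i : Lp ℝ p μ) =ᵐ[μ] fun x => ∑ i ∈ t, c i * (A i).indicator 1 x := by
  classical
  induction t using Finset.induction_on with
  | empty =>
    filter_upwards [Lp.coeFn_zero ℝ p μ] with x hx
    rw [Finset.sum_empty, Finset.sum_empty, hx, Pi.zero_apply]
  | insert a t ha ih =>
    filter_upwards [ih fun i hi => he i (Finset.mem_insert_of_mem hi),
      he a (Finset.mem_insert_self a t), Lp.coeFn_add (c a • e a) (∑ i ∈ t, c i • e i),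
      Lp.coeFn_smul (c a) (e a)] with x h1 h2 h3 h4
    rw [Finset.sum_insert ha, Finset.sum_insert ha, h3, Pi.add_apply, h1, h4, Pi.smul_apply, h2,
      smul_eq_mul]

/-- A homogeneous continuous map on `L^p` that is additive on functions with disjoint supports is
additive. -/
theorem map_add_of_map_add_disjoint {E : Type*} [AddCommGroup E] [Module ℝ E] [TopologicalSpace E]
    [T2Space E] [ContinuousAdd E] [Fact (1 ≤ p)] (hp0 : p ≠ 0) (hp : p ≠ ∞) {T : Lp ℝ p μ → E}
    (hT : Continuous T) (hsmul : ∀ (c : ℝ) (f : Lp ℝ p μ), T (c • f) = c • T f)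
    (hadd : ∀ f g : Lp ℝ p μ, (∀ᵐ x ∂μ, f x = 0 ∨ g x = 0) → T (f + g) = T f + T g)
    (f g : Lp ℝ p μ) : T (f + g) = T f + T g := by
  have h0 : T 0 = 0 := by simpa using hsmul 0 0
  refine isClosed_property2 (Lp.simpleFunc.denseRange hp)
    (p := fun f g : Lp ℝ p μ => T (f + g) = T f + T g) ?_ ?_ f g
  · exact isClosed_eq (hT.comp (continuous_fst.add continuous_snd))
      ((hT.comp continuous_fst).add (hT.comp continuous_snd))
  intro f g
  have hf := Lp.simpleFunc.toSimpleFunc_eq_toFun f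
  have hg := Lp.simpleFunc.toSimpleFunc_eq_toFun g
  have hf' := Lp.simpleFunc.memLp f
  have hg' := Lp.simpleFunc.memLp g
  set a := Lp.simpleFunc.toSimpleFunc f
  set b := Lp.simpleFunc.toSimpleFunc g
  -- The fibres of the pair form a common partition on which both simple functions are constant.
  let h := a.pair b
  have hfin : ∀ y : ℝ × ℝ, y ≠ 0 → μ (h ⁻¹' {y}) < ∞ := by
    intro y hy
    by_cases h1 : y.1 = 0
    · have h2 : y.2 ≠ 0 := fun h2 => hy (Prod.ext h1 h2)
      refine (measure_mono ?_).trans_lt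
        (SimpleFunc.measure_preimage_lt_top_of_memLp hp0 hp b hg' y.2 h2)
      rintro x rfl
      rfl
    · refine (measure_mono ?_).trans_lt
        (SimpleFunc.measure_preimage_lt_top_of_memLp hp0 hp a hf' y.1 h1)
      rintro x rfl
      rfl
  -- The fibre over 0 may have infinite measure, so its indicator need not lie in `L^p`; the dummy
  -- vector 0 stands in, and the sums below omit this fibre.
  have hex : ∀ y : ℝ × ℝ, ∃ e : Lp ℝ p μ, y ≠ 0 → e =ᵐ[μ] (h ⁻¹' {y}).indicator 1 := by
    intro y
    by_cases hy : y = 0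
    · exact ⟨0, fun h => absurd hy h⟩
    · exact ⟨indicatorConstLp p (h.measurableSet_fiber y) (hfin y hy).ne 1, fun _ =>
        indicatorConstLp_coeFn⟩
  choose e he using hex
  let t := h.range.filter (· ≠ 0)
  -- Taking for `φ` the two coordinates and their sum expands `T f`, `T g` and `T (f + g)` over the
  -- same vectors `T (e y)`.
  have hsum : ∀ (φ : ℝ × ℝ → ℝ), φ 0 = 0 → ∀ F : Lp ℝ p μ, F =ᵐ[μ] (fun x => φ (h x)) →
      T F = ∑ y ∈ t, φ y • T (e y) := by
    intro φ hφ F hF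
    have hFsum : F = ∑ y ∈ t, φ y • e y := by
      refine Lp.ext ?_
      filter_upwards [hF, coeFn_sum_smul_indicator t φ (fun y => h ⁻¹' {y}) e
        fun i hi => he i (Finset.mem_filter.1 hi).2] with x h1 h2
      rw [h1, h2]
      by_cases hx : h x = 0
      · rw [hx, hφ, Finset.sum_eq_zero]
        intro y hy
        rw [Set.indicator_of_notMem, mul_zero]
        intro hxy
        exact (Finset.mem_filter.1 hy).2 (hxy.symm.trans hx)
      · rw [Finset.sum_eq_single (h x)]
        · simp
        · intro y _ hy
          rw [Set.indicator_of_notMem, mul_zero]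
          intro hxy
          exact hy hxy.symm
        · intro hx'
          exact absurd (Finset.mem_filter.2 ⟨h.mem_range_self x, hx⟩) hx'
    rw [hFsum, map_sum_of_disjoint h0 hadd]
    · simp only [hsmul]
    · intro y hy z hz hyz
      filter_upwards [he y (Finset.mem_filter.1 hy).2, he z (Finset.mem_filter.1 hz).2,
        Lp.coeFn_smul (φ y) (e y), Lp.coeFn_smul (φ z) (e z)] with x h1 h2 h3 h4
      rw [h3, h4, Pi.smul_apply, Pi.smul_apply, h1, h2]
      by_cases hx : h x = y
      · right
        rw [Set.indicator_of_notMem, smul_zero]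
        intro hxz
        exact hyz (hx.symm.trans hxz)
      · left
        rw [Set.indicator_of_notMem (show x ∉ h ⁻¹' {y} from hx), smul_zero]
  have e1 := hsum Prod.fst rfl f hf.symm
  have e2 := hsum Prod.snd rfl g hg.symm
  have e3 := hsum (fun y => y.1 + y.2) (by simp) (f + g) (by
    filter_upwards [Lp.coeFn_add (f : Lp ℝ p μ) g, hf, hg] with x h1 h2 h3
    rw [h1, Pi.add_apply, ← h2, ← h3]
    rfl)
  rw [e1, e2, e3, ← Finset.sum_add_distrib]
  simp only [add_smul]

section Conjugation

variable [Fact (1 ≤ p)] (hp : 0 < p.toReal) (hq : 0 < q.toReal)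

/-- The scalar undergoes the signed powers `q / p` and `p / q`, which are mutually inverse. -/
theorem mazurMap_conj_smul (U : Lp ℝ p μ ≃ₗᵢ[ℝ] Lp ℝ p ν) (c : ℝ) (f : Lp ℝ q μ) :
    mazurMap hp hq (U (mazurMap hq hp (c • f))) = c • mazurMap hp hq (U (mazurMap hq hp f)) := by
  rw [mazurMap_smul, map_smul, mazurMap_smul, signedRpow_signedRpow (by positivity)]
  field_simp

/-- The inner Mazur map and `U` both keep disjoint pairs disjoint, and all three factors are
additive on such pairs. Continuity holds in both directions: Hölder estimate for the inner Mazur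
map, local Lipschitz estimate for the outer. -/
theorem mazurMap_conj_add [Fact (1 ≤ q)] (hp2 : 2 < p.toReal) (hpq : q.toReal ≤ p.toReal)
    (U : Lp ℝ p μ ≃ₗᵢ[ℝ] Lp ℝ p ν) (f g : Lp ℝ q μ) :
    mazurMap hp hq (U (mazurMap hq hp (f + g))) =
      mazurMap hp hq (U (mazurMap hq hp f)) + mazurMap hp hq (U (mazurMap hq hp g)) := by
  refine map_add_of_map_add_disjoint (by rintro rfl; simp at hq) (by rintro rfl; simp at hq)
    (T := fun f => mazurMap hp hq (U (mazurMap hq hp f))) ?_ (mazurMap_conj_smul hp hq U) ?_ f g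
  · exact (continuous_mazurMap_of_ge hp hq hpq).comp
      (U.continuous.comp (continuous_mazurMap_of_le hq hp hpq))
  · intro f g h
    rw [mazurMap_add_of_disjoint hq hp h, map_add, mazurMap_add_of_disjoint]
    exact U.map_disjoint hp2 (mazurMap_disjoint hq hp h)

end Conjugation

theorem mazurMap_self (hp : 0 < p.toReal) (f : Lp ℝ p μ) : mazurMap hp hp f = f := by
  refine Lp.ext ?_
  filter_upwards [coeFn_mazurMap hp hp f] with x hx
  rw [hx, div_self hp.ne', signedRpow_one]

end Lamperti

/-! ### The conjugated representation on real `L²` -/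

section Conjugate

variable {X : Type*} [MeasurableSpace X] {μ : Measure X} {p : ℝ≥0∞} [Fact (1 ≤ p)]

theorem toReal_two_pos : 0 < (2 : ℝ≥0∞).toReal := by norm_num

/-- At `p = 2` Clarkson's inequality degenerates to the parallelogram law and no longer detects
disjointness, but there the Mazur map is the identity. -/
theorem mazurMap_conj_add_two (hp : 0 < p.toReal) (hp2 : 2 ≤ p.toReal)
    (U : Lp ℝ p μ ≃ₗᵢ[ℝ] Lp ℝ p μ) (f g : Lp ℝ 2 μ) :
    mazurMap hp toReal_two_pos (U (mazurMap toReal_two_pos hp (f + g))) =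
      mazurMap hp toReal_two_pos (U (mazurMap toReal_two_pos hp f)) +
        mazurMap hp toReal_two_pos (U (mazurMap toReal_two_pos hp g)) := by
  rcases hp2.eq_or_lt with h | h
  · obtain rfl : p = 2 := by
      rw [← ENNReal.ofReal_toReal (ENNReal.toReal_pos_iff.1 hp).2.ne, ← h]
      norm_num
    simp only [mazurMap_self, map_add]
  · exact mazurMap_conj_add hp _ h (by simpa using hp2) U f g

/-- The conjugate by the Mazur map of a linear isometry of `L^p`, as a linear isometry of `L²`. -/
noncomputable def mazurConj (hp : 2 ≤ p.toReal) (U : Lp ℝ p μ ≃ₗᵢ[ℝ] Lp ℝ p μ) :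
    Lp ℝ 2 μ ≃ₗᵢ[ℝ] Lp ℝ 2 μ where
  toFun f := mazurMap (by linarith) toReal_two_pos (U (mazurMap toReal_two_pos (by linarith) f))
  invFun f :=
    mazurMap (by linarith) toReal_two_pos (U.symm (mazurMap toReal_two_pos (by linarith) f))
  map_add' f g := mazurMap_conj_add_two _ hp U f g
  map_smul' c f := mazurMap_conj_smul _ _ U c f
  left_inv f := by simp only [mazurMap_mazurMap, LinearIsometryEquiv.symm_apply_apply]
  right_inv f := by simp only [mazurMap_mazurMap, LinearIsometryEquiv.apply_symm_apply]
  norm_map' f := by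
    have hp0 : 0 < p.toReal := by linarith
    change ‖mazurMap hp0 toReal_two_pos (U (mazurMap toReal_two_pos hp0 f))‖ = ‖f‖
    rw [norm_mazurMap, U.norm_map, ← norm_mazurMap hp0 toReal_two_pos, mazurMap_mazurMap]

theorem mazurConj_apply (hp : 2 ≤ p.toReal) (hp0 : 0 < p.toReal) (U : Lp ℝ p μ ≃ₗᵢ[ℝ] Lp ℝ p μ)
    (f : Lp ℝ 2 μ) : mazurConj hp U f =
      mazurMap hp0 toReal_two_pos (U (mazurMap toReal_two_pos hp0 f)) := rfl

/-- The conjugate by the Mazur map of an orthogonal representation on `L^p`, as an orthogonal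
representation on `L²`. -/
noncomputable def mazurRep {G : Type*} [Group G] (hp : 2 ≤ p.toReal)
    (π : G →* (Lp ℝ p μ ≃ₗᵢ[ℝ] Lp ℝ p μ)) : G →* (Lp ℝ 2 μ ≃ₗᵢ[ℝ] Lp ℝ 2 μ) where
  toFun g := mazurConj hp (π g)
  map_one' := by
    ext1 f
    rw [mazurConj_apply hp (by linarith), map_one]
    exact mazurMap_mazurMap _ _ f
  map_mul' g h := by
    ext1 f
    change _ = mazurConj hp (π g) (mazurConj hp (π h) f)
    simp only [mazurConj_apply hp (by linarith), mazurMap_mazurMap, map_mul]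
    rfl

theorem mazurRep_apply {G : Type*} [Group G] (hp : 2 ≤ p.toReal) (hp0 : 0 < p.toReal)
    (π : G →* (Lp ℝ p μ ≃ₗᵢ[ℝ] Lp ℝ p μ)) (g : G) (f : Lp ℝ 2 μ) : mazurRep hp π g f =
      mazurMap hp0 toReal_two_pos (π g (mazurMap toReal_two_pos hp0 f)) := rfl

theorem mazurRep_mazurMap {G : Type*} [Group G] (hp : 2 ≤ p.toReal) (hp0 : 0 < p.toReal)
    (π : G →* (Lp ℝ p μ ≃ₗᵢ[ℝ] Lp ℝ p μ)) (g : G) (f : Lp ℝ p μ) :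
    mazurRep hp π g (mazurMap hp0 toReal_two_pos f) = mazurMap hp0 toReal_two_pos (π g f) := by
  rw [mazurRep_apply hp hp0, mazurMap_mazurMap]

/-- The inverse Mazur map sends vectors fixed by the conjugate to vectors fixed by `π`, and by the
norm formula only 0 goes to 0. -/
theorem mazurRep_eq_zero_of_mem_invariantVectors {G : Type*} [Group G] (hp : 2 ≤ p.toReal)
    (π : G →* (Lp ℝ p μ ≃ₗᵢ[ℝ] Lp ℝ p μ))
    (hπ : ∀ ξ : Lp ℝ p μ, ξ ∈ invariantVectors π → ξ = 0) (f : Lp ℝ 2 μ)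
    (hf : f ∈ invariantVectors (mazurRep hp π)) : f = 0 := by
  have hp0 : 0 < p.toReal := by linarith
  have h : mazurMap toReal_two_pos hp0 f = 0 := by
    refine hπ _ fun g => ?_
    have := congrArg (mazurMap toReal_two_pos hp0) (hf g)
    rwa [mazurRep_apply hp hp0, mazurMap_mazurMap] at this
  have h2 := norm_mazurMap toReal_two_pos hp0 f
  rw [h, norm_zero, eq_comm, Real.rpow_eq_zero (norm_nonneg f)
      (div_pos toReal_two_pos hp0).ne'] at h2
  exact norm_eq_zero.1 h2

end Conjugate

/-! ### Complexification of real `L²` representations -/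

section Complexification

variable {X : Type*} [MeasurableSpace X] {μ : Measure X}

/-- The real part of a complex `L²` function. -/
noncomputable def lpRe (f : Lp ℂ 2 μ) : Lp ℝ 2 μ := Complex.reCLM.compLp f

/-- The imaginary part of a complex `L²` function. -/
noncomputable def lpIm (f : Lp ℂ 2 μ) : Lp ℝ 2 μ := Complex.imCLM.compLp f

/-- The complex `L²` function with given real and imaginary parts. -/
noncomputable def lpMk (a b : Lp ℝ 2 μ) : Lp ℂ 2 μ :=
  Complex.ofRealCLM.compLp a + Complex.I • Complex.ofRealCLM.compLp b

theorem coeFn_lpRe (f : Lp ℂ 2 μ) : ∀ᵐ x ∂μ, lpRe f x = (f x).re :=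
  Complex.reCLM.coeFn_compLp f

theorem coeFn_lpIm (f : Lp ℂ 2 μ) : ∀ᵐ x ∂μ, lpIm f x = (f x).im :=
  Complex.imCLM.coeFn_compLp f

theorem coeFn_lpMk (a b : Lp ℝ 2 μ) : ∀ᵐ x ∂μ, lpMk a b x = ⟨a x, b x⟩ := by
  filter_upwards [Complex.ofRealCLM.coeFn_compLp a, Complex.ofRealCLM.coeFn_compLp b,
    Lp.coeFn_add (Complex.ofRealCLM.compLp a) (Complex.I • Complex.ofRealCLM.compLp b),
    Lp.coeFn_smul Complex.I (Complex.ofRealCLM.compLp b)] with x h1 h2 h3 h4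
  rw [lpMk, h3, Pi.add_apply, h1, h4, Pi.smul_apply, h2]
  apply Complex.ext <;> simp

@[simp] theorem lpRe_lpMk (a b : Lp ℝ 2 μ) : lpRe (lpMk a b) = a := by
  refine Lp.ext ?_
  filter_upwards [coeFn_lpRe (lpMk a b), coeFn_lpMk a b] with x h1 h2
  rw [h1, h2]

@[simp] theorem lpIm_lpMk (a b : Lp ℝ 2 μ) : lpIm (lpMk a b) = b := by
  refine Lp.ext ?_
  filter_upwards [coeFn_lpIm (lpMk a b), coeFn_lpMk a b] with x h1 h2
  rw [h1, h2]

@[simp] theorem lpMk_lpRe_lpIm (f : Lp ℂ 2 μ) : lpMk (lpRe f) (lpIm f) = f := by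
  refine Lp.ext ?_
  filter_upwards [coeFn_lpMk (lpRe f) (lpIm f), coeFn_lpRe f, coeFn_lpIm f] with x h1 h2 h3
  rw [h1, h2, h3]

theorem lpMk_add (a b c d : Lp ℝ 2 μ) : lpMk (a + c) (b + d) = lpMk a b + lpMk c d := by
  refine Lp.ext ?_
  filter_upwards [coeFn_lpMk (a + c) (b + d), coeFn_lpMk a b, coeFn_lpMk c d, Lp.coeFn_add a c,
    Lp.coeFn_add b d, Lp.coeFn_add (lpMk a b) (lpMk c d)] with x h1 h2 h3 h4 h5 h6
  rw [h1, h6, Pi.add_apply, h2, h3, h4, h5]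
  rfl

theorem lpRe_add (f g : Lp ℂ 2 μ) : lpRe (f + g) = lpRe f + lpRe g :=
  map_add (Complex.reCLM.compLpₗ 2 μ) f g

theorem lpIm_add (f g : Lp ℂ 2 μ) : lpIm (f + g) = lpIm f + lpIm g :=
  map_add (Complex.imCLM.compLpₗ 2 μ) f g

theorem lpRe_smul (c : ℂ) (f : Lp ℂ 2 μ) : lpRe (c • f) = c.re • lpRe f - c.im • lpIm f := by
  refine Lp.ext ?_
  filter_upwards [coeFn_lpRe (c • f), coeFn_lpRe f, coeFn_lpIm f, Lp.coeFn_smul c f,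
    Lp.coeFn_smul c.re (lpRe f), Lp.coeFn_smul c.im (lpIm f),
    Lp.coeFn_sub (c.re • lpRe f) (c.im • lpIm f)] with x h1 h2 h3 h4 h5 h6 h7
  rw [h1, h4, h7, Pi.sub_apply, h5, h6]
  simp [h2, h3]

theorem lpIm_smul (c : ℂ) (f : Lp ℂ 2 μ) : lpIm (c • f) = c.re • lpIm f + c.im • lpRe f := by
  refine Lp.ext ?_
  filter_upwards [coeFn_lpIm (c • f), coeFn_lpRe f, coeFn_lpIm f, Lp.coeFn_smul c f,
    Lp.coeFn_smul c.re (lpIm f), Lp.coeFn_smul c.im (lpRe f),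
    Lp.coeFn_add (c.re • lpIm f) (c.im • lpRe f)] with x h1 h2 h3 h4 h5 h6 h7
  rw [h1, h4, h7, Pi.add_apply, h5, h6]
  simp [h2, h3]

theorem norm_lpMk_sq (a b : Lp ℝ 2 μ) : ‖lpMk a b‖ ^ 2 = ‖a‖ ^ 2 + ‖b‖ ^ 2 := by
  have h : ∀ (E : Type) [NormedAddCommGroup E] (f : Lp E 2 μ), ‖f‖ ^ 2 = ∫ x, ‖f x‖ ^ 2 ∂μ := by
    intro E _ f
    simpa using norm_rpow_eq_integral toReal_two_pos f
  have hi : ∀ f : Lp ℝ 2 μ, Integrable (fun x => ‖f x‖ ^ 2) μ := fun f => by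
    simpa using (Lp.memLp f).integrable_norm_rpow (by norm_num) (by norm_num)
  rw [h, h, h, ← integral_add (hi a) (hi b)]
  refine integral_congr_ae ?_
  filter_upwards [coeFn_lpMk a b] with x hx
  rw [hx, Complex.sq_norm, Complex.normSq_mk, Real.norm_eq_abs, Real.norm_eq_abs, sq_abs, sq_abs]
  ring

/-- The complexification of a linear isometry of real `L²`. -/
noncomputable def complexifyIsometry (V : Lp ℝ 2 μ ≃ₗᵢ[ℝ] Lp ℝ 2 μ) :
    Lp ℂ 2 μ ≃ₗᵢ[ℂ] Lp ℂ 2 μ where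
  toFun f := lpMk (V (lpRe f)) (V (lpIm f))
  invFun f := lpMk (V.symm (lpRe f)) (V.symm (lpIm f))
  map_add' f g := by rw [lpRe_add, lpIm_add, map_add, map_add, lpMk_add]
  map_smul' c f := by
    rw [RingHom.id_apply, ← lpMk_lpRe_lpIm (c • lpMk (V (lpRe f)) (V (lpIm f)))]
    simp only [lpRe_smul, lpIm_smul, lpRe_lpMk, lpIm_lpMk, map_add, map_sub, map_smul]
  left_inv f := by simp
  right_inv f := by simp
  norm_map' f := by
    change ‖lpMk (V (lpRe f)) (V (lpIm f))‖ = ‖f‖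
    rw [← sq_eq_sq₀ (norm_nonneg _) (norm_nonneg _), norm_lpMk_sq, V.norm_map, V.norm_map,
      ← norm_lpMk_sq, lpMk_lpRe_lpIm]

theorem complexifyIsometry_apply (V : Lp ℝ 2 μ ≃ₗᵢ[ℝ] Lp ℝ 2 μ) (f : Lp ℂ 2 μ) :
    complexifyIsometry V f = lpMk (V (lpRe f)) (V (lpIm f)) := rfl

/-- The complexification of an orthogonal representation on real `L²`. -/
noncomputable def complexifyRep {G : Type*} [Group G] (ρ : G →* (Lp ℝ 2 μ ≃ₗᵢ[ℝ] Lp ℝ 2 μ)) :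
    G →* (Lp ℂ 2 μ ≃ₗᵢ[ℂ] Lp ℂ 2 μ) where
  toFun g := complexifyIsometry (ρ g)
  map_one' := by
    ext1 f
    simp [complexifyIsometry_apply]
  map_mul' g h := by
    ext1 f
    simp [complexifyIsometry_apply]

theorem complexifyRep_apply {G : Type*} [Group G] (ρ : G →* (Lp ℝ 2 μ ≃ₗᵢ[ℝ] Lp ℝ 2 μ)) (g : G)
    (f : Lp ℂ 2 μ) : complexifyRep ρ g f = lpMk (ρ g (lpRe f)) (ρ g (lpIm f)) := rfl

theorem invariantVectors_complexifyRep_eq_bot {G : Type*} [Group G]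
    (ρ : G →* (Lp ℝ 2 μ ≃ₗᵢ[ℝ] Lp ℝ 2 μ)) (hρ : ∀ f, f ∈ invariantVectors ρ → f = 0) :
    invariantVectors (complexifyRep ρ) = ⊥ := by
  refine (Submodule.eq_bot_iff _).2 fun f hf => ?_
  have hre : lpRe f = 0 := hρ _ fun g => by
    simpa [complexifyRep_apply] using congrArg lpRe (hf g)
  have him : lpIm f = 0 := hρ _ fun g => by
    simpa [complexifyRep_apply] using congrArg lpIm (hf g)
  have h := norm_lpMk_sq (lpRe f) (lpIm f)
  rw [lpMk_lpRe_lpIm, hre, him] at h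
  simpa using h

theorem nnnorm_lpMk_zero (a : Lp ℝ 2 μ) : ‖lpMk a 0‖₊ = ‖a‖₊ := by
  have h := norm_lpMk_sq a 0
  rw [norm_zero, zero_pow two_ne_zero, add_zero, sq_eq_sq₀ (norm_nonneg _) (norm_nonneg _)] at h
  exact NNReal.eq h

/-- A Kazhdan pair controls real `L²` representations without invariant vectors. -/
theorem IsKazhdanPair.le_sup_of_real {X : Type v} [MeasurableSpace X] {μ : Measure X} {G : Type u}
    [Group G] {S : Finset G} {ε : ℝ≥0} (h : IsKazhdanPair.{u, v} S ε)
    (ρ : G →* (Lp ℝ 2 μ ≃ₗᵢ[ℝ] Lp ℝ 2 μ)) (hρ : ∀ f, f ∈ invariantVectors ρ → f = 0)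
    (a : Lp ℝ 2 μ) : ε * ‖a‖₊ ≤ S.sup fun g => ‖ρ g a - a‖₊ := by
  -- The real vector `a` embeds isometrically as `lpMk a 0`. Without invariant vectors the
  -- orthogonal complement is the whole space. Since `X : Type v`, the space `Lp ℂ 2 μ` lies in the
  -- universe over which Kazhdan pairs are tested.
  have h1 := h (Lp ℂ 2 μ) (complexifyRep ρ) (lpMk a 0) (by
    rw [invariantVectors_complexifyRep_eq_bot ρ hρ, Submodule.bot_orthogonal_eq_top]
    trivial)
  rw [nnnorm_lpMk_zero] at h1
  refine h1.trans_eq (Finset.sup_congr rfl fun g _ => ?_)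
  rw [← nnnorm_lpMk_zero (ρ g a - a)]
  congr 1
  rw [complexifyRep_apply, sub_eq_iff_eq_add, ← lpMk_add]
  simp

end Complexification

/-! ### The inequality for `L^p` representations -/

theorem proposition3p3 {X : Type v} [MeasurableSpace X] (μ : MeasureTheory.Measure X)
    [MeasureTheory.SigmaFinite μ] (p : ℝ≥0∞) [Fact (1 ≤ p)] (hp : 2 ≤ p) (hp_top : p ≠ ∞)
    {G : Type u} [Group G] (hG : HasPropertyT.{u, v} G)
    (π : G →* (MeasureTheory.Lp ℝ p μ ≃ₗᵢ[ℝ] MeasureTheory.Lp ℝ p μ))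
    (hπ : ∀ ξ : MeasureTheory.Lp ℝ p μ, ξ ∈ invariantVectors π → ξ = 0)
    (S : Finset G) (hS : Subgroup.closure (S : Set G) = ⊤) (ξ : MeasureTheory.Lp ℝ p μ) :
    2 * kazhdanConstant.{u, v} S / p * ‖ξ‖ₑ ≤ S.sup fun g => ‖π g ξ - ξ‖ₑ := by
  have hp2 : 2 ≤ p.toReal := by simpa using ENNReal.toReal_mono hp_top hp
  have hp0 : 0 < p.toReal := by linarith
  rcases eq_or_ne ξ 0 with rfl | hξ
  · simp
  have hξ0 : 0 < ‖ξ‖ := norm_pos_iff.2 hξ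
  set B : ℝ≥0 := S.sup fun g => ‖π g ξ - ξ‖₊ with hB
  have hBe : (S.sup fun g => ‖π g ξ - ξ‖ₑ) = (B : ℝ≥0∞) := by
    rw [hB, ENNReal.coe_finset_sup]
    rfl
  -- Solved for the constant, the inequality bounds every admissible `ε`, hence the supremum; in
  -- particular it is finite once `ξ ≠ 0`.
  have hκ : kazhdanConstant.{u, v} S ≤ ENNReal.ofReal (p.toReal * B / (2 * ‖ξ‖)) := by
    refine iSup₂_le fun ε hε => ?_
    have h1 := hε.le_sup_of_real (mazurRep hp2 π)
      (mazurRep_eq_zero_of_mem_invariantVectors hp2 π hπ) (mazurMap hp0 toReal_two_pos ξ)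
    have h2 : (S.sup fun g => ‖mazurRep hp2 π g (mazurMap hp0 toReal_two_pos ξ) -
        mazurMap hp0 toReal_two_pos ξ‖₊) ≤
        (p.toReal / 2 * B * ‖ξ‖ ^ (p.toReal / 2 - 1)).toNNReal := by
      refine Finset.sup_le fun g hg => NNReal.le_toNNReal_of_coe_le ?_
      rw [coe_nnnorm, mazurRep_mazurMap]
      -- Both `π g ξ` and `ξ` have norm `‖ξ‖`, so the Lipschitz bound applies with `r = ‖ξ‖`.
      refine (norm_mazurMap_sub_le hp0 toReal_two_pos (by simpa using hp2)
        ((π g).norm_map ξ).le le_rfl).trans ?_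
      have hgB : ‖π g ξ - ξ‖ ≤ B := by
        exact_mod_cast Finset.le_sup (f := fun g => ‖π g ξ - ξ‖₊) hg
      rw [ENNReal.toReal_ofNat]
      gcongr
    have h3 : (ε : ℝ) * ‖ξ‖ ^ (p.toReal / 2) ≤ p.toReal / 2 * B * ‖ξ‖ ^ (p.toReal / 2 - 1) := by
      have := NNReal.coe_le_coe.2 (h1.trans h2)
      rwa [NNReal.coe_mul, coe_nnnorm, norm_mazurMap, ENNReal.toReal_ofNat,
        Real.coe_toNNReal _ (by positivity)] at this
    rw [← ENNReal.ofReal_coe_nnreal]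
    refine ENNReal.ofReal_le_ofReal ?_
    rw [le_div_iff₀ (by positivity)]
    -- Splitting off one factor `‖ξ‖` lets the power `‖ξ‖ ^ (p / 2 - 1)` cancel on both sides.
    have h4 : ‖ξ‖ ^ (p.toReal / 2) = ‖ξ‖ * ‖ξ‖ ^ (p.toReal / 2 - 1) := by
      rw [Real.rpow_sub_one hξ0.ne', mul_div_cancel₀ _ hξ0.ne']
    rw [h4, ← mul_assoc] at h3
    have h5 := le_of_mul_le_mul_right h3 (Real.rpow_pos_of_pos hξ0 _)
    linarith
  rw [hBe]
  calc 2 * kazhdanConstant.{u, v} S / p * ‖ξ‖ₑ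
      ≤ 2 * ENNReal.ofReal (p.toReal * B / (2 * ‖ξ‖)) / p * ‖ξ‖ₑ := by gcongr
    _ = ENNReal.ofReal (2 * (p.toReal * B / (2 * ‖ξ‖)) / p.toReal * ‖ξ‖) := by
      rw [ENNReal.ofReal_mul (by positivity), ENNReal.ofReal_div_of_pos hp0,
        ENNReal.ofReal_mul (by norm_num), ENNReal.ofReal_toReal hp_top, ofReal_norm,
        ENNReal.ofReal_ofNat]
    _ = B := by
      rw [← ENNReal.ofReal_coe_nnreal]
      congr 1
      field_simp
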